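/- For integers $n \ge 0$ and $m \ge 1$, an $m$-modular Hadamard matrix of size $n$, or $MH(n,m)$, is an $n \times n$ matrix $H$ with all entries in $\{1,-1\}$ such that $HH^\top \equiv nI \pmod{m}$. For all but finitely many nonnegative integers $n$, an $MH(n,11)$ exists if and only if $n$ is even or $n$ is a quadratic residue modulo $11$, that is, $n \equiv a^2 \pmod{11}$ for some integer $a$ (the case $n \equiv 0 \pmod{11}$ is included). -/

import Mathlib

/-- `H` is an `m`-modular Hadamard matrix of size `n`, an `MH(n, m)`: an `n × n` matrix with
entries `±1` such that `H Hᵀ ≡ n I (mod m)`, entry by entry. -/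
def IsModularHadamard (m : ℕ) {n : ℕ} (H : Matrix (Fin n) (Fin n) ℤ) : Prop :=
  (∀ i j, H i j = 1 ∨ H i j = -1) ∧
    ∀ i j, (H * H.transpose) i j ≡ ((n : ℤ) • (1 : Matrix (Fin n) (Fin n) ℤ)) i j [ZMOD m]

/-- An `MH(n, m)` exists. -/
def ExistsMH (n m : ℕ) : Prop :=
  ∃ H : Matrix (Fin n) (Fin n) ℤ, IsModularHadamard m H

/-!
Write `p = 11` and work over `ZMod p`.

*Necessity.* If `H Hᵀ = n I` over a field, then `(det H)² = n ^ n`, so for odd `n` the order `n` is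
a square.

*Sufficiency.* A weighing matrix of order `r` and weight `w` is an `r × r` matrix `W` with entries
`0, ±1` and `W Wᵀ = w I` modulo `p`. Let `K` be a Hadamard matrix of order `n = 4 w` modulo `p` that
contains a `±1` filling of `W` as a submatrix on rows `R` and columns `C`. Repeat each of these rows
and columns `p + 1` times. Since `p + 1 = 1` modulo `p`, inner products of copies of different rows
are unchanged, but two copies of the same row now have inner product `n`. Replacing the constant
blocks `± J` over the support of `W` by `± (2 I - J)`, whose row sums are still `±1` modulo `p`,
lowers that inner product by `4 w = n` and, as `W Wᵀ` is diagonal, changes no other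
(`IsHadamardZMod.blowUp`). The result has order `n + p r` and contains `K`, so the step can be
iterated, also along several weighing matrices in turn (`IsHadamardZMod.existsMH_add`).

A Sylvester matrix of order `2 ^ k` with `k` large contains every given `±1` pattern
(`containsPattern_sylvester`). As `2` is a primitive root modulo `11`, every nonzero residue class
contains arbitrarily large powers of two to start from. Steps of two coprime orders then reach all
large members of the class (`eventually_existsMH`), and steps of two orders with greatest common
divisor `2` reach all large even ones. For weight `2 ^ (2 j)` the orders `7 ^ j` and `2 ^ (2 j)` are
available, from Kronecker powers of a `W(7, 4)` and of a `W(2, 2)`; for weight `2 ^ (2 j + 1)` the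
orders are `2 * 7 ^ j` and `2 ^ (2 j + 1)` (`eventually_existsMH_eleven`).
In the class of `0` the all-ones matrix is enough.
-/

open Matrix Finset

/-! ### Hadamard and weighing matrices modulo `p` -/

/-- A `±1` matrix over `ZMod p` whose rows are pairwise orthogonal and have square norm the
number of columns. Rows and columns are indexed by arbitrary finite types. -/
def IsHadamardZMod {p : ℕ} {I J : Type*} [Fintype J] [DecidableEq I]
    (K : Matrix I J (ZMod p)) : Prop :=
  (∀ i j, K i j = 1 ∨ K i j = -1) ∧ K * Kᵀ = (Fintype.card J : ZMod p) • 1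

/-- A weighing matrix modulo `p`: entries in `{0, 1, -1}` and `W Wᵀ = w I`. -/
def IsWeighing {p : ℕ} {R S : Type*} [Fintype S] [DecidableEq R] (w : ZMod p)
    (W : Matrix R S (ZMod p)) : Prop :=
  (∀ i j, W i j = 0 ∨ W i j = 1 ∨ W i j = -1) ∧ W * Wᵀ = w • 1

/-- `K` has a submatrix that agrees with `W` at every nonzero entry of `W`. -/
def ContainsPattern {p : ℕ} {I J R S : Type*} (K : Matrix I J (ZMod p))
    (W : Matrix R S (ZMod p)) : Prop :=
  ∃ (f : R ↪ I) (g : S ↪ J), ∀ s t, W s t ≠ 0 → K (f s) (g t) = W s t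

theorem ContainsPattern.of_submatrix {p : ℕ} {I J I' J' R S : Type*} {K : Matrix I J (ZMod p)}
    {K' : Matrix I' J' (ZMod p)} {W : Matrix R S (ZMod p)} (φ : I ↪ I') (ψ : J ↪ J')
    (h : K'.submatrix φ ψ = K) (hW : ContainsPattern K W) : ContainsPattern K' W := by
  obtain ⟨f, g, hfg⟩ := hW
  refine ⟨f.trans φ, g.trans ψ, fun s t hst => ?_⟩
  rw [← hfg s t hst, ← h]
  rfl

theorem IsHadamardZMod.submatrix {p : ℕ} {I J I' J' : Type*} [Fintype J] [Fintype J']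
    [DecidableEq I] [DecidableEq I'] {K : Matrix I J (ZMod p)} (hK : IsHadamardZMod K)
    (e : I' ≃ I) (e' : J' ≃ J) : IsHadamardZMod (K.submatrix e e') := by
  refine ⟨fun i j => hK.1 _ _, ?_⟩
  rw [Matrix.transpose_submatrix, Matrix.submatrix_mul_equiv, hK.2, Fintype.card_congr e']
  ext i j
  simp [Matrix.one_apply]

theorem IsWeighing.submatrix {p : ℕ} {R S R' S' : Type*} [Fintype S] [Fintype S']
    [DecidableEq R] [DecidableEq R'] {w : ZMod p} {W : Matrix R S (ZMod p)} (hW : IsWeighing w W)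
    (e : R' ≃ R) (e' : S' ≃ S) : IsWeighing w (W.submatrix e e') := by
  refine ⟨fun i j => hW.1 _ _, ?_⟩
  rw [Matrix.transpose_submatrix, Matrix.submatrix_mul_equiv, hW.2]
  ext i j
  simp [Matrix.one_apply]

/-! ### Blowing up a Hadamard matrix along a weighing matrix -/

/-- The matrix obtained from `K`, with rows `R ⊕ U` and columns `R ⊕ V`, by repeating `p + 1` times
each row and each column indexed by `R`, and negating, in the block over an entry of the support
of `W`, all entries off the diagonal of that block. The formula does this negation only if `W`
agrees with `K` on the support of `W`. -/
def blowUp {p : ℕ} {R U V : Type*} (K : Matrix (R ⊕ U) (R ⊕ V) (ZMod p))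
    (W : Matrix R R (ZMod p)) :
    Matrix ((R × Fin (p + 1)) ⊕ U) ((R × Fin (p + 1)) ⊕ V) (ZMod p) :=
  Matrix.fromBlocks
    (Matrix.of fun x y => K.toBlocks₁₁ x.1 y.1 - 2 * W x.1 y.1 +
      if x.2 = y.2 then 2 * W x.1 y.1 else 0)
    (K.toBlocks₁₂.submatrix Prod.fst id) (K.toBlocks₂₁.submatrix id Prod.fst) K.toBlocks₂₂

theorem blowUp_submatrix {p : ℕ} {R U V : Type*} (K : Matrix (R ⊕ U) (R ⊕ V) (ZMod p))
    (W : Matrix R R (ZMod p)) :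
    (blowUp K W).submatrix (Sum.map (fun s => (s, 0)) id) (Sum.map (fun s => (s, 0)) id) = K := by
  ext (i | i) (j | j) <;> simp [blowUp, Matrix.toBlocks₁₁, Matrix.toBlocks₁₂, Matrix.toBlocks₂₁,
    Matrix.toBlocks₂₂]

/-- The inner product of two rows of a block matrix with blocks `x J + y I` of size `p + 1`. The
terms that do not involve the position inside the blocks are multiplied by `p + 1 = 1`. -/
theorem sum_blowUp_block {p : ℕ} {R : Type*} [Fintype R] (x x' y y' : R → ZMod p)
    (a a' : Fin (p + 1)) :
    ∑ q : R × Fin (p + 1), (x q.1 + if a = q.2 then y q.1 else 0) *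
        (x' q.1 + if a' = q.2 then y' q.1 else 0) =
      ∑ t, (x t * x' t + x t * y' t + y t * x' t + if a = a' then y t * y' t else 0) := by
  rw [Fintype.sum_prod_type]
  refine Finset.sum_congr rfl fun t _ => ?_
  simp [add_mul, mul_add, Finset.sum_add_distrib]
  ring

theorem IsHadamardZMod.blowUp {p : ℕ} {R U V : Type*} [Fintype R] [Fintype V] [DecidableEq R]
    [DecidableEq U] {K : Matrix (R ⊕ U) (R ⊕ V) (ZMod p)} {W : Matrix R R (ZMod p)}
    (hK : IsHadamardZMod K) {w : ZMod p} (hW : IsWeighing w W)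
    (hKW : ∀ s t, W s t ≠ 0 → K (Sum.inl s) (Sum.inl t) = W s t)
    (hw : 4 * w = Fintype.card R + Fintype.card V) :
    IsHadamardZMod (blowUp K W) := by
  obtain ⟨hK1, hK2⟩ := hK
  refine ⟨?_, ?_⟩
  · rintro (⟨s, a⟩ | i) (⟨t, b⟩ | j)
    · have h1 := hK1 (Sum.inl s) (Sum.inl t)
      simp only [_root_.blowUp, Matrix.fromBlocks_apply₁₁, Matrix.of_apply, Matrix.toBlocks₁₁]
      by_cases h0 : W s t = 0
      · simpa [h0] using h1
      · have h2 := hKW s t h0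
        rw [h2] at h1 ⊢
        split_ifs
        · simpa using h1
        · rcases h1 with h1 | h1 <;> rw [h1]
          · right; ring
          · left; ring
    · exact hK1 _ _
    · exact hK1 _ _
    · exact hK1 _ _
  · have key : ∀ i i', ∑ t, K i (Sum.inl t) * K i' (Sum.inl t) +
        ∑ j, K i (Sum.inr j) * K i' (Sum.inr j) =
          if i = i' then (Fintype.card R + Fintype.card V : ZMod p) else 0 := by
      intro i i'
      have := congrFun (congrFun hK2 i) i'
      simpa [Matrix.mul_apply, Matrix.one_apply] using this
    have keyW : ∀ s s', ∑ t, W s t * W s' t = if s = s' then w else 0 := by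
      intro s s'
      have := congrFun (congrFun hW.2 s) s'
      simpa [Matrix.mul_apply, Matrix.one_apply] using this
    have hcard : (Fintype.card (R × Fin (p + 1) ⊕ V) : ZMod p) =
        Fintype.card R + Fintype.card V := by
      simp
    rw [hcard]
    ext (⟨s, a⟩ | i) (⟨s', a'⟩ | i')
    · simp only [Matrix.mul_apply, Fintype.sum_sum_type, _root_.blowUp, Matrix.transpose_apply,
        Matrix.fromBlocks_apply₁₁, Matrix.fromBlocks_apply₁₂, Matrix.of_apply,
        Matrix.submatrix_apply, Matrix.toBlocks₁₁, Matrix.toBlocks₁₂, id]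
      rw [sum_blowUp_block (fun t => K (Sum.inl s) (Sum.inl t) - 2 * W s t)
        (fun t => K (Sum.inl s') (Sum.inl t) - 2 * W s' t) (fun t => 2 * W s t)
        (fun t => 2 * W s' t)]
      have h1 := key (Sum.inl s) (Sum.inl s')
      have h2 := keyW s s'
      -- Modulo `p`, the `J`-part of the product is `A Aᵀ - 4 W Wᵀ` and the `I`-part is `4 W Wᵀ`,
      -- where `A` is the `R × R` block of `K`.
      have h3 : ∑ t, ((K (Sum.inl s) (Sum.inl t) - 2 * W s t) *
            (K (Sum.inl s') (Sum.inl t) - 2 * W s' t)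
          + (K (Sum.inl s) (Sum.inl t) - 2 * W s t) * (2 * W s' t)
          + 2 * W s t * (K (Sum.inl s') (Sum.inl t) - 2 * W s' t)
          + if a = a' then 2 * W s t * (2 * W s' t) else 0)
          = ∑ t, K (Sum.inl s) (Sum.inl t) * K (Sum.inl s') (Sum.inl t)
            - 4 * ∑ t, W s t * W s' t + if a = a' then 4 * ∑ t, W s t * W s' t else 0 := by
        split_ifs
        · simp only [Finset.mul_sum, ← Finset.sum_sub_distrib, ← Finset.sum_add_distrib]
          exact Finset.sum_congr rfl fun t _ => by ring
        · simp only [Finset.mul_sum, ← Finset.sum_sub_distrib, add_zero]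
          exact Finset.sum_congr rfl fun t _ => by ring
      rw [h3, h2]
      by_cases hs : s = s' <;> by_cases ha : a = a' <;>
        simp [hs, ha, hw] at h1 ⊢ <;> linear_combination h1
    · have h1 := key (Sum.inl s) (Sum.inr i')
      simp only [Matrix.mul_apply, Fintype.sum_sum_type, _root_.blowUp, Matrix.transpose_apply,
        Matrix.fromBlocks_apply₁₁, Matrix.fromBlocks_apply₁₂, Matrix.fromBlocks_apply₂₁,
        Matrix.fromBlocks_apply₂₂, Matrix.of_apply, Matrix.toBlocks₂₁, Matrix.toBlocks₂₂,
        Matrix.submatrix_apply, Matrix.toBlocks₁₁, Matrix.toBlocks₁₂, id, Fintype.sum_prod_type]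
      simp [← Finset.sum_mul, Finset.sum_add_distrib] at h1 ⊢
      linear_combination h1
    · have h1 := key (Sum.inr i) (Sum.inl s')
      simp only [Matrix.mul_apply, Fintype.sum_sum_type, _root_.blowUp, Matrix.transpose_apply,
        Matrix.fromBlocks_apply₁₁, Matrix.fromBlocks_apply₁₂, Matrix.fromBlocks_apply₂₁,
        Matrix.fromBlocks_apply₂₂, Matrix.of_apply, Matrix.toBlocks₂₁, Matrix.toBlocks₂₂,
        Matrix.submatrix_apply, Matrix.toBlocks₁₁, Matrix.toBlocks₁₂, id, Fintype.sum_prod_type]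
      simp [← Finset.mul_sum, Finset.sum_add_distrib] at h1 ⊢
      linear_combination h1
    · have h1 := key (Sum.inr i) (Sum.inr i')
      simp [Matrix.mul_apply, Fintype.sum_sum_type, _root_.blowUp, Matrix.toBlocks₂₁,
        Matrix.toBlocks₂₂, Fintype.sum_prod_type, Matrix.one_apply] at h1 ⊢
      exact h1

/-- If `4 w = n`, then a Hadamard matrix of order `n` modulo `p` that contains a weighing matrix of
order `r` and weight `w` is a submatrix of one of order `n + p r`. -/
theorem IsHadamardZMod.exists_extension {p n r : ℕ} {K : Matrix (Fin n) (Fin n) (ZMod p)}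
    (hK : IsHadamardZMod K) {w : ZMod p} {W : Matrix (Fin r) (Fin r) (ZMod p)}
    (hW : IsWeighing w W) (hKW : ContainsPattern K W) (hw : 4 * w = n) :
    ∃ K' : Matrix (Fin (n + p * r)) (Fin (n + p * r)) (ZMod p), IsHadamardZMod K' ∧
      ∃ φ ψ : Fin n ↪ Fin (n + p * r), K'.submatrix φ ψ = K := by
  classical
  obtain ⟨f, g, hfg⟩ := hKW
  let split (f : Fin r ↪ Fin n) : Fin r ⊕ ((Set.range f)ᶜ : Set (Fin n)) ≃ Fin n :=
    ((Equiv.ofInjective f f.injective).sumCongr (Equiv.refl _)).trans (Equiv.Set.sumCompl _)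
  have card_compl (f : Fin r ↪ Fin n) : r + Fintype.card ((Set.range f)ᶜ : Set (Fin n)) = n := by
    simpa using Fintype.card_congr (split f)
  have hK₁ : IsHadamardZMod (K.submatrix (split f) (split g)) := hK.submatrix _ _
  have hH := hK₁.blowUp hW (fun s t h => by simpa [split] using hfg s t h)
    (by rw [hw, Fintype.card_fin, ← Nat.cast_add, card_compl g])
  have hc (f : Fin r ↪ Fin n) :
      Fintype.card ((Fin r × Fin (p + 1)) ⊕ ((Set.range f)ᶜ : Set (Fin n))) =
        n + p * r := by
    rw [Fintype.card_sum, Fintype.card_prod, Fintype.card_fin, Fintype.card_fin]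
    linarith [card_compl f]
  let e (f : Fin r ↪ Fin n) := Fintype.equivFinOfCardEq (hc f)
  let φ (f : Fin r ↪ Fin n) : Fin n ↪ Fin (n + p * r) :=
    ⟨fun i => e f (Sum.map (fun s => (s, 0)) id ((split f).symm i)), by
      refine (e f).injective.comp (Function.Injective.comp ?_ (split f).symm.injective)
      exact Function.Injective.sumMap (fun a b h => by simpa using h) Function.injective_id⟩
  refine ⟨_, hH.submatrix (e f).symm (e g).symm, φ f, φ g, ?_⟩
  ext i j
  have := congrFun (congrFun (blowUp_submatrix (K.submatrix (split f) (split g)) W)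
    ((split f).symm i)) ((split g).symm j)
  simpa [φ] using this

/-! ### Sylvester matrices -/

/-- The Sylvester matrix of order `2 ^ |A|`: rows and columns are the subsets of `A`, and the entry
at `(x, y)` is `(-1) ^ |x ∩ y|`. -/
def sylvester (p : ℕ) (A : Type*) [DecidableEq A] : Matrix (Finset A) (Finset A) (ZMod p) :=
  fun x y => ∏ z ∈ y, if z ∈ x then -1 else 1

theorem isHadamardZMod_sylvester (p : ℕ) (A : Type*) [DecidableEq A] [Fintype A] :
    IsHadamardZMod (sylvester p A) := by
  refine ⟨fun x y => ?_, ?_⟩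
  · refine Finset.prod_induction _ (fun a : ZMod p => a = 1 ∨ a = -1) ?_ (Or.inl rfl) ?_
    · rintro a b (rfl | rfl) (rfl | rfl) <;> simp
    · intro z _
      split_ifs <;> simp
  · ext x x'
    simp only [Matrix.mul_apply, Matrix.transpose_apply, sylvester, ← Finset.prod_mul_distrib]
    rw [← Finset.powerset_univ, ← Finset.prod_one_add]
    by_cases h : x = x'
    · subst h
      rw [Finset.prod_congr rfl (g := fun _ => (2 : ZMod p))]
      · simp
      · intro z _
        split_ifs <;> norm_num
    · obtain ⟨z, hz⟩ : ∃ z, ¬ (z ∈ x ↔ z ∈ x') := by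
        by_contra! H
        exact h (Finset.ext H)
      rw [Finset.prod_eq_zero (Finset.mem_univ z)]
      · simp [h]
      · by_cases h1 : z ∈ x <;> by_cases h2 : z ∈ x' <;> simp_all

/-- A large Sylvester matrix contains every small pattern: for disjoint points `e s` and `e' t`,
the row of `s` is `{e s}`, and the column of `t` consists of the `e s` with `W s t = -1` together
with `e' t`, which keeps the columns distinct. -/
theorem containsPattern_sylvester {p : ℕ} {A R S : Type*} [DecidableEq A] [Fintype A] [Fintype R]
    [Fintype S] (e : R ⊕ S ↪ A) {W : Matrix R S (ZMod p)}
    (hW : ∀ s t, W s t = 0 ∨ W s t = 1 ∨ W s t = -1) : ContainsPattern (sylvester p A) W := by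
  classical
  refine ⟨⟨fun s => {e (Sum.inl s)}, fun a b h => by simpa using h⟩,
    ⟨fun t => insert (e (Sum.inr t)) ((univ.filter fun s => W s t = -1).image (e ∘ Sum.inl)),
      ?_⟩, ?_⟩
  · intro a b h
    have : e (Sum.inr a) ∈ insert (e (Sum.inr b))
        ((univ.filter fun s => W s b = -1).image (e ∘ Sum.inl)) := by
      have h' : insert (e (Sum.inr a)) ((univ.filter fun s => W s a = -1).image (e ∘ Sum.inl)) =
          insert (e (Sum.inr b)) ((univ.filter fun s => W s b = -1).image (e ∘ Sum.inl)) := h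
      rw [← h']
      exact Finset.mem_insert_self _ _
    simpa using this
  · intro s t h0
    have hs := hW s t
    change (∏ z ∈ insert (e (Sum.inr t)) ((univ.filter fun s => W s t = -1).image (e ∘ Sum.inl)),
      if z ∈ ({e (Sum.inl s)} : Finset A) then (-1 : ZMod p) else 1) = W s t
    simp only [Finset.mem_singleton]
    rw [Finset.prod_ite_eq']
    by_cases h1 : W s t = -1
    · simp [h1]
    · simp_all

/-! ### Orders of weighing matrices -/

/-- A weighing matrix of order `r` and weight `w` modulo `p` exists. -/
def ExistsWeighing (p r : ℕ) (w : ZMod p) : Prop :=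
  ∃ W : Matrix (Fin r) (Fin r) (ZMod p), IsWeighing w W

theorem ExistsWeighing.mul {p r r' : ℕ} {w w' : ZMod p} (h : ExistsWeighing p r w)
    (h' : ExistsWeighing p r' w') : ExistsWeighing p (r * r') (w * w') := by
  obtain ⟨W, hW, hWW⟩ := h
  obtain ⟨W', hW', hWW'⟩ := h'
  have : IsWeighing (w * w') (Matrix.kroneckerMap (· * ·) W W') := by
    refine ⟨?_, ?_⟩
    · rintro ⟨i, i'⟩ ⟨j, j'⟩
      rw [Matrix.kroneckerMap_apply]
      rcases hW i j with h | h | h <;> rcases hW' i' j' with h' | h' | h' <;> simp [h, h']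
    · rw [← Matrix.kroneckerMap_transpose, ← Matrix.mul_kronecker_mul, hWW, hWW',
        Matrix.smul_kronecker, Matrix.kronecker_smul, Matrix.one_kronecker_one, smul_smul]
  exact ⟨_, this.submatrix finProdFinEquiv.symm finProdFinEquiv.symm⟩

theorem ExistsWeighing.pow {p r : ℕ} {w : ZMod p} (h : ExistsWeighing p r w) (k : ℕ) :
    ExistsWeighing p (r ^ k) (w ^ k) := by
  induction k with
  | zero => exact ⟨1, fun i j => by simp only [Matrix.one_apply]; split_ifs <;> simp,
      by
        rw [Matrix.transpose_one, Matrix.mul_one, pow_zero w, one_smul]⟩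
  | succ k ih => rw [pow_succ, pow_succ]; exact ih.mul h

theorem existsWeighing_two (p : ℕ) : ExistsWeighing p 2 2 := by
  refine ⟨!![1, 1; 1, -1], fun i j => ?_, ?_⟩
  · fin_cases i <;> fin_cases j <;> simp
  · ext i j
    fin_cases i <;> fin_cases j <;> norm_num [Matrix.mul_apply, Fin.sum_univ_succ]

/-- The circulant with first column `(-1, 1, 1, 0, 1, 0, 0)`. -/
theorem existsWeighing_seven : ExistsWeighing 11 7 4 := by
  refine ⟨Matrix.circulant ![-1, 1, 1, 0, 1, 0, 0], ?_, ?_⟩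
  · simp only [Matrix.circulant_apply]
    decide
  · ext i j
    simp only [Matrix.mul_apply, Matrix.circulant_apply, Matrix.transpose_apply,
      Matrix.smul_apply, Matrix.one_apply]
    revert i j
    decide

/-! ### Orders of Hadamard matrices modulo a prime -/

theorem IsHadamardZMod.existsMH {p n : ℕ} {K : Matrix (Fin n) (Fin n) (ZMod p)}
    (hK : IsHadamardZMod K) : ExistsMH n p := by
  let H : Matrix (Fin n) (Fin n) ℤ := Matrix.of fun i j => if K i j = 1 then 1 else -1
  have hH : ∀ i j, (H i j : ZMod p) = K i j := by
    intro i j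
    by_cases h : K i j = 1
    · simp [H, h]
    · simp only [H, Matrix.of_apply, if_neg h]
      rw [(hK.1 i j).resolve_left h]
      simp
  refine ⟨H, fun i j => by simp only [H, Matrix.of_apply]; split_ifs <;> simp, fun i j => ?_⟩
  rw [← ZMod.intCast_eq_intCast_iff]
  have h := congrFun (congrFun hK.2 i) j
  simp only [Matrix.mul_apply, Matrix.transpose_apply, ← hH, Fintype.card_fin,
    Matrix.smul_apply, Matrix.one_apply] at h
  simp only [Matrix.mul_apply, Matrix.transpose_apply, Matrix.smul_apply, Matrix.one_apply]
  push_cast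
  rw [h]
  split_ifs <;> simp

/-- The determinant of a Hadamard matrix of order `n` modulo `p` squares to `n ^ n`. -/
theorem ExistsMH.even_or_isSquare {p n : ℕ} [Fact p.Prime] (h : ExistsMH n p) :
    Even n ∨ IsSquare (n : ZMod p) := by
  obtain ⟨H, -, hH⟩ := h
  refine (Nat.even_or_odd n).imp_right fun ⟨k, hk⟩ => ?_
  let K : Matrix (Fin n) (Fin n) (ZMod p) := H.map (Int.castRingHom (ZMod p))
  have hK : K * Kᵀ = (n : ZMod p) • 1 := by
    ext i j
    have h := (ZMod.intCast_eq_intCast_iff _ _ _).2 (hH i j)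
    simp only [Matrix.mul_apply, Matrix.transpose_apply, Matrix.smul_apply,
      Matrix.one_apply] at h
    push_cast at h
    simp only [K, Matrix.mul_apply, Matrix.transpose_apply, Matrix.smul_apply, Matrix.one_apply,
      Matrix.map_apply, eq_intCast]
    rw [h]
    split_ifs <;> simp
  have hdet := congrArg Matrix.det hK
  rw [Matrix.det_mul, Matrix.det_transpose, Matrix.det_smul, Matrix.det_one, mul_one,
    Fintype.card_fin] at hdet
  by_cases h0 : (n : ZMod p) = 0
  · rw [h0]
    exact IsSquare.zero
  · refine ⟨K.det / (n : ZMod p) ^ k, ?_⟩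
    have hn : (n : ZMod p) ^ n = n * ((n : ZMod p) ^ k * (n : ZMod p) ^ k) := by
      conv_lhs => rw [show (n : ZMod p) ^ n = (n : ZMod p) ^ (2 * k + 1) from congrArg _ hk]
      ring
    rw [div_mul_div_comm, hdet, hn]
    field_simp

theorem existsMH_of_natCast_eq_zero {p n : ℕ} (hn : (n : ZMod p) = 0) : ExistsMH n p := by
  refine IsHadamardZMod.existsMH (K := Matrix.of fun _ _ => 1) ⟨fun _ _ => Or.inl rfl, ?_⟩
  ext i j
  simp [Matrix.mul_apply, hn]

/-- Iterated extension along two weighing matrices of the same weight. The patterns survive each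
step because the old matrix is a submatrix of the new one. -/
theorem IsHadamardZMod.existsMH_add {p n r₁ r₂ : ℕ} {K : Matrix (Fin n) (Fin n) (ZMod p)}
    (hK : IsHadamardZMod K) {w : ZMod p} {W₁ : Matrix (Fin r₁) (Fin r₁) (ZMod p)}
    {W₂ : Matrix (Fin r₂) (Fin r₂) (ZMod p)} (hW₁ : IsWeighing w W₁) (hW₂ : IsWeighing w W₂)
    (h₁ : ContainsPattern K W₁) (h₂ : ContainsPattern K W₂) (hw : 4 * w = n) (a b : ℕ) :
    ExistsMH (n + p * (r₁ * a + r₂ * b)) p := by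
  induction a generalizing n with
  | zero =>
    induction b generalizing n with
    | zero => simpa using hK.existsMH
    | succ b ih =>
      obtain ⟨K', hK', φ, ψ, h⟩ := hK.exists_extension hW₂ h₂ hw
      convert ih hK' (h₁.of_submatrix φ ψ h) (h₂.of_submatrix φ ψ h) (by simp [hw]) using 1
      ring
  | succ a ih =>
    obtain ⟨K', hK', φ, ψ, h⟩ := hK.exists_extension hW₁ h₁ hw
    convert ih hK' (h₁.of_submatrix φ ψ h) (h₂.of_submatrix φ ψ h) (by simp [hw]) using 1
    ring

/-- If there are weighing matrices of weight `w` of orders `d r₁` and `d r₂`, with `r₁` and `r₂`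
coprime, and a large power of two divisible by `d` is `4 w` modulo `p`, then all large multiples
of `d` that are `4 w` modulo `p` are orders of Hadamard matrices modulo `p`. -/
theorem eventually_existsMH {p d r₁ r₂ k : ℕ} [NeZero p] {w : ZMod p} (hr : r₁.Coprime r₂)
    (hdp : d.Coprime p) (h₁ : ExistsWeighing p (d * r₁) w) (h₂ : ExistsWeighing p (d * r₂) w)
    (hk₁ : 2 * (d * r₁) ≤ k) (hk₂ : 2 * (d * r₂) ≤ k) (hdk : d ∣ 2 ^ k) (hw : 4 * w = 2 ^ k) :
    ∀ᶠ n : ℕ in Filter.atTop, (n : ZMod p) = 4 * w → d ∣ n → ExistsMH n p := by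
  obtain ⟨W₁, hW₁⟩ := h₁
  obtain ⟨W₂, hW₂⟩ := h₂
  have emb (r : ℕ) (hr : 2 * r ≤ k) : Nonempty (Fin r ⊕ Fin r ↪ Fin k) :=
    Function.Embedding.nonempty_of_card_le (by simp; omega)
  obtain ⟨e₁⟩ := emb _ hk₁
  obtain ⟨e₂⟩ := emb _ hk₂
  let e : Fin (2 ^ k) ≃ Finset (Fin k) := (Fintype.equivFinOfCardEq (by simp)).symm
  have hK : IsHadamardZMod ((sylvester p (Fin k)).submatrix e e) :=
    (isHadamardZMod_sylvester p (Fin k)).submatrix e e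
  have hS : ((sylvester p (Fin k)).submatrix e e).submatrix e.symm.toEmbedding
      e.symm.toEmbedding = sylvester p (Fin k) := by
    ext x y
    simp
  have c₁ := (containsPattern_sylvester e₁ hW₁.1).of_submatrix _ _ hS
  have c₂ := (containsPattern_sylvester e₂ hW₂.1).of_submatrix _ _ hS
  filter_upwards [Filter.eventually_ge_atTop (2 ^ k + p * (d * (r₁ * r₂)))] with n hn hnw hdn
  obtain ⟨m, rfl⟩ := Nat.exists_eq_add_of_le ((Nat.le_add_right _ _).trans hn)
  have hpm : p ∣ m := by
    rw [← ZMod.natCast_eq_zero_iff]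
    simpa [hw] using hnw
  obtain ⟨t, rfl⟩ :=
    Nat.Coprime.mul_dvd_of_dvd_of_dvd hdp.symm hpm ((Nat.dvd_add_right hdk).1 hdn)
  have hd : 0 < d := Nat.pos_of_dvd_of_pos hdk (by positivity)
  have ht : r₁ * r₂ ≤ t := by
    have h : p * d * (r₁ * r₂) ≤ p * d * t := by
      rw [mul_assoc]
      exact Nat.le_of_add_le_add_left hn
    exact Nat.le_of_mul_le_mul_left h (Nat.mul_pos (NeZero.pos p) hd)
  obtain ⟨a, b, rfl⟩ := Nat.exists_add_mul_eq_of_gcd_dvd_of_mul_pred_le r₁ r₂ t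
    (by rw [hr.gcd_eq_one]; exact one_dvd t)
    ((Nat.mul_le_mul (Nat.pred_le _) (Nat.pred_le _)).trans ht)
  convert hK.existsMH_add hW₁ hW₂ c₁ c₂ (by simpa using hw) a b using 1
  ring

/-! ### Orders of Hadamard matrices modulo 11 -/

/-- The even powers `4 ^ j` of the primitive root `2` are the weights coming from `W(7, 4)`, the odd
powers `2 * 4 ^ j` those coming from its product with `W(2, 2)`. The second weighing matrix is in
both cases a Hadamard matrix whose order is a power of two. -/
theorem eventually_existsMH_eleven (c : ZMod 11) :
    ∀ᶠ n : ℕ in Filter.atTop, (n : ZMod 11) = c → (Even n ∨ IsSquare c) → ExistsMH n 11 := by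
  by_cases hc : c = 0
  · exact Filter.Eventually.of_forall fun n hn _ => existsMH_of_natCast_eq_zero (hn.trans hc)
  obtain ⟨a, rfl⟩ : ∃ a : ℕ, c = 4 * 2 ^ a := by
    have : ∀ c : ZMod 11, c ≠ 0 → ∃ a : Fin 10, c = 4 * 2 ^ (a : ℕ) := by decide
    obtain ⟨a, ha⟩ := this c hc
    exact ⟨a, ha⟩
  -- Exponents `k ≡ a + 2` modulo `10`, the order of `2`, give `2 ^ k = 4 * 2 ^ a`.
  have hpow (m : ℕ) : 4 * (2 : ZMod 11) ^ a = 2 ^ (a + 2 + 10 * m) := by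
    rw [pow_add, pow_add, pow_mul, show (2 : ZMod 11) ^ 10 = 1 by decide]
    ring
  have hcop (i j : ℕ) : (7 ^ i).Coprime (2 ^ j) := Nat.Coprime.pow _ _ (by norm_num)
  obtain ⟨j, hj⟩ := Nat.even_or_odd' a
  have h7 : 0 < 7 ^ j := by positivity
  have h4 : 0 < 2 ^ (2 * j) := by positivity
  obtain rfl | rfl := hj
  · have h₁ : ExistsWeighing 11 (1 * 7 ^ j) (2 ^ (2 * j)) := by
      rw [one_mul, pow_mul, show (2 : ZMod 11) ^ 2 = 4 by decide]
      exact existsWeighing_seven.pow j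
    have h₂ : ExistsWeighing 11 (1 * 2 ^ (2 * j)) (2 ^ (2 * j)) := by
      rw [one_mul]
      exact (existsWeighing_two 11).pow _
    filter_upwards [eventually_existsMH (k := 2 * j + 2 + 10 * (7 ^ j + 2 ^ (2 * j))) (hcop _ _)
      (Nat.coprime_one_left 11) h₁ h₂ (by omega) (by omega) (one_dvd _) (hpow _)] with n hn hnc _
    exact hn hnc (one_dvd n)
  · have h₁ : ExistsWeighing 11 (2 * 7 ^ j) (2 ^ (2 * j + 1)) := by
      rw [pow_succ', pow_mul, show (2 : ZMod 11) ^ 2 = 4 by decide]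
      exact (existsWeighing_two 11).mul (existsWeighing_seven.pow j)
    have h₂ : ExistsWeighing 11 (2 * 2 ^ (2 * j)) (2 ^ (2 * j + 1)) := by
      rw [← pow_succ']
      exact (existsWeighing_two 11).pow _
    have hsq : ¬ IsSquare (4 * 2 ^ (2 * j + 1) : ZMod 11) := by
      rintro ⟨x, hx⟩
      have hy : ∀ y : ZMod 11, y * y ≠ 2 := by decide
      have h20 : (2 : ZMod 11) ≠ 0 := by decide
      have : Fact (Nat.Prime 11) := ⟨by norm_num⟩
      have hne : (2 : ZMod 11) ^ (j + 1) ≠ 0 := pow_ne_zero _ h20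
      apply hy (x / 2 ^ (j + 1))
      rw [div_mul_div_comm, ← hx]
      field_simp
      ring
    filter_upwards [eventually_existsMH (k := 2 * j + 1 + 2 + 10 * (7 ^ j + 2 ^ (2 * j)))
      (hcop _ _) (by norm_num) h₁ h₂ (by omega) (by omega)
      (dvd_pow_self 2 (by omega)) (hpow _)] with n hn hnc hn2
    exact hn hnc (hn2.resolve_right hsq).two_dvd

theorem mainTheorem4 :
    {n : ℕ | ¬ (ExistsMH n 11 ↔ (Even n ∨ IsSquare (n : ZMod 11)))}.Finite := by
  have : Fact (Nat.Prime 11) := ⟨by norm_num⟩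
  have h : ∀ᶠ n : ℕ in Filter.atTop, ExistsMH n 11 ↔ (Even n ∨ IsSquare (n : ZMod 11)) := by
    filter_upwards [Filter.eventually_all.2 eventually_existsMH_eleven] with n hn
    exact ⟨ExistsMH.even_or_isSquare, hn n rfl⟩
  rwa [← Nat.cofinite_eq_atTop, Filter.eventually_cofinite] at h
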